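/- Let $H_n=\sum_{k=1}^n \frac1k$ (so $H_0=0$), let $\zeta$ be the Riemann zeta function, and for integers $a\ge 2$, $b\ge 1$ let $\zeta(a,b)=\sum_{n=1}^\infty\sum_{m=1}^{n-1}\frac{1}{n^a m^b}$. Then for every integer $s\ge 2$ (all the series converging) $$\sum_{n=0}^\infty \frac{H_n}{(2n+1)^{2s-1}} = (1-4^{-s})(2s-1)\zeta(2s) - (2-4^{1-s})\log(2)\,\zeta(2s-1) + (1-2^{-s})^2\zeta(s)^2 - \sum_{k=2}^{s} 2(1-2^{-k})(1-2^{k-2s})\,\zeta(k)\zeta(2s-k)$$ and $$\sum_{j=2}^{2s-1} 2^{1-j}\zeta(j,2s-j) = \tfrac12(1-2^{1-s})^2\zeta(s)^2 + \tfrac12\,(2^{3-2s}+2s-3)\,\zeta(2s) - \sum_{k=2}^{s}(2^{k-1}-1)(2^{1-k}-4^{1-s})\,\zeta(k)\zeta(2s-k).$$ -/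

import Mathlib

/-- The `n`-th term `∑_{m=1}^{n-1} 1 / (n^a m^b)` of the series of the double zeta value `ζ(a,b)`.
It is `0` (an empty sum) for `n = 0` and `n = 1`. -/
noncomputable def doubleZetaTerm (a b n : ℕ) : ℝ :=
  ∑ m ∈ Finset.Ico 1 n, 1 / ((n : ℝ) ^ a * (m : ℝ) ^ b)

/-- The double zeta value `ζ(a,b) = ∑_{n ≥ 1} ∑_{m=1}^{n-1} 1 / (n^a m^b)`, for `a ≥ 2`, `b ≥ 1`.
The summation index also runs through `n = 0`, where the term is `0`. -/
noncomputable def doubleZeta (a b : ℕ) : ℝ :=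
  ∑' n : ℕ, doubleZetaTerm a b n

open Filter Topology Finset

/-! Both identities come from one partial fraction computation. For `u ≠ v`, the sum of `u^{-(i+2)}
v^{-(q-i+2)}` over `0 ≤ i ≤ q` equals `u^{-(q+2)} / (v (v - u))` plus its mirror image. Put signs on
it and sum over all pairs from a sequence `u_n`: products of zeta-type values equal a diagonal term
plus twice a series whose inner sums have closed forms (`hasSum_inv_pow_mul_of_tendsto`).

For `u_n = 2n + 1` without signs, the inner sums contain `H_m` and `log 2`, which gives the first
identity after solving for the harmonic series.

For `u_n = n + 1` with signs `(-1)^n`, they contain partial sums of the alternating harmonic series.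
The weighted double zeta sum is a geometric sum in `1/(2n)` and `1/m`; it splits into two double
series whose inner sums involve the same partial sums. Adding the three series cancels all of these
and `log 2` termwise, leaving only a multiple of `ζ(2s)` (`sum_mul_doubleZeta_eq`).

With `q = 2s - 4` the convolutions are symmetric; folding them in half yields the sums over `2 ≤ k ≤
s` and the separate `ζ(s)^2` term. -/

/-! ### Majorants for double series -/

theorem summable_inv_mul_sqrt : Summable fun n : ℕ => ((n : ℝ) * √n)⁻¹ := by
  have h := Real.summable_nat_rpow_inv.2 (by norm_num : (1 : ℝ) < 3 / 2)
  refine h.congr fun n => ?_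
  rcases Nat.eq_zero_or_pos n with rfl | hn
  · norm_num
  · have : (0 : ℝ) < n := by exact_mod_cast hn
    rw [show (3 / 2 : ℝ) = 1 + 1 / 2 by norm_num, Real.rpow_add this, Real.rpow_one,
      Real.sqrt_eq_rpow]

theorem summable_prod_inv_mul_sqrt :
    Summable fun p : ℕ × ℕ => ((p.1 : ℝ) * √p.1)⁻¹ * ((p.2 : ℝ) * √p.2)⁻¹ :=
  summable_inv_mul_sqrt.mul_of_nonneg summable_inv_mul_sqrt
    (fun _ => by positivity) (fun _ => by positivity)

/-- Since `y ≤ x + d ≤ 2xd`, half a power of `y` can be borrowed from `x d`. The resulting majorant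
is a product of two convergent series with exponent `3/2`. -/
theorem inv_sq_mul_mul_le {x y d : ℝ} (hx : 1 ≤ x) (hy : 1 ≤ y) (hd : 1 ≤ d) (h : y ≤ x + d) :
    (x ^ 2 * y * d)⁻¹ ≤ 2 * ((x * √x)⁻¹ * (y * √y)⁻¹) := by
  have hsx : 0 < √x := Real.sqrt_pos.2 (by linarith)
  have hsy : 0 < √y := Real.sqrt_pos.2 (by linarith)
  have hx0 : 0 < x := by linarith
  have hy0 : 0 < y := by linarith
  have hd0 : 0 < d := by linarith
  have h1 : √x * √y ≤ 2 * (x * d) := by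
    rw [← Real.sqrt_mul hx0.le, Real.sqrt_le_iff]
    refine ⟨by positivity, ?_⟩
    have h2 : y ≤ 2 * (x * d) := by nlinarith
    have h3 : 1 ≤ x * d := by nlinarith
    have h4 : x ≤ x * d := by nlinarith
    nlinarith [mul_le_mul h4 h2 hy0.le (by positivity)]
  have h2 : x * √x * (y * √y) ≤ 2 * (x ^ 2 * y * d) := by
    have := mul_le_mul_of_nonneg_left h1 (by positivity : 0 ≤ x * y)
    nlinarith
  rw [← mul_inv, inv_eq_one_div, ← div_eq_mul_inv, div_le_div_iff₀ (by positivity) (by positivity)]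
  linarith

/-! ### Partial fractions summed over all pairs -/

theorem sum_pow_mul_pow_eq (q : ℕ) {u v : ℝ} (hu : u ≠ 0) (hv : v ≠ 0) (huv : u ≠ v) :
    ∑ i ∈ range (q + 1), u⁻¹ ^ (i + 2) * v⁻¹ ^ (q - i + 2)
      = u⁻¹ ^ (q + 2) * (v⁻¹ * (v - u)⁻¹) + v⁻¹ ^ (q + 2) * (u⁻¹ * (u - v)⁻¹) := by
  have h := geom_sum₂_mul u⁻¹ v⁻¹ (q + 1)
  have h1 : u - v ≠ 0 := sub_ne_zero.2 huv
  have h2 : v - u ≠ 0 := sub_ne_zero.2 huv.symm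
  have h3 : u⁻¹ - v⁻¹ = (v - u) * (u⁻¹ * v⁻¹) := by field_simp
  have h4 : ∑ i ∈ range (q + 1), u⁻¹ ^ (i + 2) * v⁻¹ ^ (q - i + 2)
      = (∑ i ∈ range (q + 1), u⁻¹ ^ i * v⁻¹ ^ (q + 1 - 1 - i)) * (u⁻¹ ^ 2 * v⁻¹ ^ 2) := by
    rw [Finset.sum_mul]
    refine Finset.sum_congr rfl fun i _ => ?_
    rw [Nat.add_sub_cancel, pow_add, pow_add]
    ring
  have h5 : (u - v)⁻¹ = -(v - u)⁻¹ := by rw [← neg_sub, inv_neg]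
  rw [h3] at h
  rw [h4, h5]
  generalize ∑ i ∈ range (q + 1), u⁻¹ ^ i * v⁻¹ ^ (q + 1 - 1 - i) = S at *
  have h6 : S * (u⁻¹ * v⁻¹) = (u⁻¹ ^ (q + 1) - v⁻¹ ^ (q + 1)) * (v - u)⁻¹ := by
    rw [← h]; field_simp
  calc S * (u⁻¹ ^ 2 * v⁻¹ ^ 2) = S * (u⁻¹ * v⁻¹) * (u⁻¹ * v⁻¹) := by ring
    _ = _ := by rw [h6]; ring

theorem summable_inv_pow_mul_inv_sub (q : ℕ) {u ε : ℕ → ℝ} (hu : ∀ n : ℕ, (n : ℝ) + 1 ≤ u n)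
    (hd : ∀ m n, m ≠ n → 1 ≤ |u n - u m|) (hε : ∀ n, |ε n| = 1) :
    Summable fun p : ℕ × ℕ =>
      ε p.1 * (u p.1)⁻¹ ^ (q + 2) * (ε p.2 * ((u p.2)⁻¹ * (u p.2 - u p.1)⁻¹)) := by
  have hs : Summable fun p : ℕ × ℕ =>
      2 * ((((p.1 + 1 : ℕ) : ℝ) * √((p.1 + 1 : ℕ) : ℝ))⁻¹
        * (((p.2 + 1 : ℕ) : ℝ) * √((p.2 + 1 : ℕ) : ℝ))⁻¹) := by
    have h := (summable_nat_add_iff 1).2 summable_inv_mul_sqrt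
    exact (h.mul_of_nonneg h (fun _ => by positivity) (fun _ => by positivity)).mul_left 2
  refine Summable.of_norm_bounded hs ?_
  rintro ⟨m, n⟩
  have hum := hu m
  have hun := hu n
  have hm0 : (0 : ℝ) ≤ m := m.cast_nonneg
  have hn0 : (0 : ℝ) ≤ n := n.cast_nonneg
  dsimp only
  rcases eq_or_ne m n with rfl | hmn
  -- The diagonal terms vanish through `0⁻¹ = 0`, so no restriction to `m ≠ n` is needed.
  · simp only [sub_self, inv_zero, mul_zero, norm_zero]
    positivity
  · have hd' := hd m n hmn
    have hux : 0 < u m := by linarith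
    have huy : 0 < u n := by linarith
    have h1 := inv_sq_mul_mul_le (x := u m) (y := u n) (d := |u n - u m|) (by linarith)
      (by linarith) hd' (by linarith [le_abs_self (u n - u m)])
    rw [Real.norm_eq_abs, abs_mul, abs_mul, abs_mul, abs_mul, hε, hε, abs_pow, abs_inv, abs_inv,
      abs_inv, abs_of_pos hux, abs_of_pos huy, one_mul, one_mul]
    have h2 : (u m)⁻¹ ^ (q + 2) ≤ (u m)⁻¹ ^ 2 :=
      pow_le_pow_of_le_one (by positivity) (inv_le_one_of_one_le₀ (by linarith)) (by omega)
    calc (u m)⁻¹ ^ (q + 2) * ((u n)⁻¹ * |u n - u m|⁻¹)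
        ≤ (u m)⁻¹ ^ 2 * ((u n)⁻¹ * |u n - u m|⁻¹) := by gcongr
      _ = (u m ^ 2 * u n * |u n - u m|)⁻¹ := by rw [mul_inv, mul_inv, inv_pow]; ring
      _ ≤ _ := h1
      _ ≤ _ := by push_cast; gcongr

/-- The double series `f` and its transpose have the same sum, and together with the diagonal they
make up the convolution of the `L i`; hence the division by 2. Inner sums enter only as limits `r m`
of partial sums, so that they can be computed from divergent or conditionally convergent pieces. -/
theorem hasSum_inv_pow_mul_of_tendsto (q : ℕ) {u ε : ℕ → ℝ} (hu : ∀ n : ℕ, (n : ℝ) + 1 ≤ u n)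
    (hd : ∀ m n, m ≠ n → 1 ≤ |u n - u m|) (hε : ∀ n, |ε n| = 1) {L : ℕ → ℝ}
    (hL : ∀ i ≤ q, HasSum (fun n => ε n * (u n)⁻¹ ^ (i + 2)) (L i)) {D : ℝ}
    (hD : HasSum (fun n => (u n)⁻¹ ^ (q + 4)) D) {r : ℕ → ℝ}
    (hr : ∀ m, Tendsto (fun K => ∑ n ∈ range (m + 1 + K), ε n * ((u n)⁻¹ * (u n - u m)⁻¹))
      atTop (𝓝 (r m))) :
    HasSum (fun m => ε m * (u m)⁻¹ ^ (q + 2) * r m)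
      ((∑ i ∈ range (q + 1), L i * L (q - i) - (q + 1) * D) / 2) := by
  have hpos : ∀ n, 0 < u n := fun n => by
    have := hu n
    have : (0 : ℝ) ≤ n := n.cast_nonneg
    linarith
  set f : ℕ × ℕ → ℝ := fun p =>
    ε p.1 * (u p.1)⁻¹ ^ (q + 2) * (ε p.2 * ((u p.2)⁻¹ * (u p.2 - u p.1)⁻¹)) with hf
  have hfs : Summable f := summable_inv_pow_mul_inv_sub q hu hd hε
  have hfib : ∀ m, HasSum (fun n => f (m, n)) (ε m * (u m)⁻¹ ^ (q + 2) * r m) := by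
    intro m
    have h1 : Summable fun n => f (m, n) := hfs.prod_factor m
    have hc : ε m * (u m)⁻¹ ^ (q + 2) ≠ 0 := by
      refine mul_ne_zero ?_ (pow_ne_zero _ (inv_ne_zero (hpos m).ne'))
      intro h
      simpa [h] using hε m
    have h2 : Summable fun n => ε n * ((u n)⁻¹ * (u n - u m)⁻¹) := (summable_mul_left_iff hc).1 h1
    -- The fibre is summable, so its sum must be the limit `r m` of the shifted partial sums.
    have h3 := h2.hasSum.tendsto_sum_nat.comp (tendsto_add_atTop_nat (m + 1))
    have h4 := hr m
    simp_rw [add_comm (m + 1)] at h4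
    have h5 := tendsto_nhds_unique h4 h3
    rw [h5]
    exact h2.hasSum.mul_left _
  have hf1 : HasSum f (∑' p, f p) := hfs.hasSum
  have hf2 : HasSum (fun p : ℕ × ℕ => f p.swap) (∑' p, f p) :=
    (Equiv.prodComm ℕ ℕ).hasSum_iff (f := f) |>.2 hf1
  have hdiag : HasSum (fun p : ℕ × ℕ => if p.1 = p.2 then (q + 1) * (u p.1)⁻¹ ^ (q + 4) else 0)
      ((q + 1) * D) := by
    have hi : Function.Injective fun n : ℕ => (n, n) := fun a b h => (Prod.ext_iff.1 h).1
    refine (hi.hasSum_iff ?_).1 ?_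
    · rintro ⟨a, b⟩ hab
      refine if_neg fun h => hab ⟨a, ?_⟩
      simp_all
    · simpa [Function.comp_def] using hD.mul_left ((q : ℝ) + 1)
  have hprod : HasSum (fun p : ℕ × ℕ => ∑ i ∈ range (q + 1),
      (ε p.1 * (u p.1)⁻¹ ^ (i + 2)) * (ε p.2 * (u p.2)⁻¹ ^ (q - i + 2)))
      (∑ i ∈ range (q + 1), L i * L (q - i)) := by
    refine hasSum_sum fun i hi => ?_
    have h1 := hL i (by have := mem_range.1 hi; omega)
    have h2 := hL (q - i) (by omega)
    have h3 := summable_mul_of_summable_norm h1.summable.norm h2.summable.norm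
    exact h1.mul h2 h3
  have hpt : ∀ p : ℕ × ℕ, ∑ i ∈ range (q + 1),
      (ε p.1 * (u p.1)⁻¹ ^ (i + 2)) * (ε p.2 * (u p.2)⁻¹ ^ (q - i + 2))
      = (if p.1 = p.2 then (q + 1) * (u p.1)⁻¹ ^ (q + 4) else 0) + (f p + f p.swap) := by
    rintro ⟨m, n⟩
    simp only [hf, Prod.swap]
    rcases eq_or_ne m n with rfl | hmn
    · have he : ε m * ε m = 1 := by rw [← abs_mul_abs_self, hε, one_mul]
      simp only [sub_self, inv_zero, mul_zero, add_zero, if_true]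
      have h : ∀ i ∈ range (q + 1), (ε m * (u m)⁻¹ ^ (i + 2)) * (ε m * (u m)⁻¹ ^ (q - i + 2))
          = (u m)⁻¹ ^ (q + 4) := by
        intro i hi
        have : q + 4 = (i + 2) + (q - i + 2) := by have := mem_range.1 hi; omega
        rw [this, pow_add _ (i + 2), mul_mul_mul_comm, he, one_mul]
      rw [Finset.sum_congr rfl h]
      simp
    · have hne : u m ≠ u n := fun h => by
        have := hd m n hmn
        norm_num [h] at this
      rw [if_neg hmn, zero_add]
      have h : ∀ i ∈ range (q + 1), (ε m * (u m)⁻¹ ^ (i + 2)) * (ε n * (u n)⁻¹ ^ (q - i + 2))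
          = ε m * ε n * ((u m)⁻¹ ^ (i + 2) * (u n)⁻¹ ^ (q - i + 2)) :=
        fun i _ => mul_mul_mul_comm _ _ _ _
      rw [Finset.sum_congr rfl h, ← Finset.mul_sum,
        sum_pow_mul_pow_eq q (hpos m).ne' (hpos n).ne' hne]
      ring
  have htot := hdiag.add (hf1.add hf2)
  rw [← funext hpt] at htot
  have heq := hprod.unique htot
  have hval : ∑' p, f p = (∑ i ∈ range (q + 1), L i * L (q - i) - (q + 1) * D) / 2 := by
    linarith
  rw [← hval]
  exact hf1.prod_fiberwise hfib

/-! ### Harmonic and alternating harmonic sums, and the inner sums -/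

/-- The partial sums `∑_{j < n} (-1)^j / (j + 1)` of the alternating harmonic series. -/
noncomputable def altHarmonic (n : ℕ) : ℝ := ∑ j ∈ range n, (-1) ^ j * ((j : ℝ) + 1)⁻¹

theorem altHarmonic_succ (n : ℕ) :
    altHarmonic (n + 1) = altHarmonic n + (-1) ^ n * ((n : ℝ) + 1)⁻¹ :=
  sum_range_succ _ _

theorem cast_harmonic_eq_sum (n : ℕ) : (harmonic n : ℝ) = ∑ j ∈ range n, ((j : ℝ) + 1)⁻¹ := by
  simp [harmonic]

theorem cast_harmonic_succ (n : ℕ) :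
    (harmonic (n + 1) : ℝ) = harmonic n + ((n : ℝ) + 1)⁻¹ := by
  simp [harmonic_succ]

theorem altHarmonic_two_mul (n : ℕ) :
    altHarmonic (2 * n) = (harmonic (2 * n) : ℝ) - harmonic n := by
  induction n with
  | zero => simp [altHarmonic]
  | succ n ih =>
    rw [show 2 * (n + 1) = 2 * n + 1 + 1 by ring, altHarmonic_succ, altHarmonic_succ,
      cast_harmonic_succ, cast_harmonic_succ, cast_harmonic_succ, ih, pow_succ, pow_mul]
    have h1 : (n : ℝ) + 1 ≠ 0 := by positivity
    have h2 : (2 * n + 1 : ℝ) + 1 ≠ 0 := by positivity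
    push_cast
    rw [neg_one_sq, one_pow, show (2 * n + 1 : ℝ) + 1 = 2 * (n + 1) by ring]
    field_simp
    ring

theorem tendsto_harmonic_two_mul_sub_harmonic :
    Tendsto (fun n : ℕ => (harmonic (2 * n) : ℝ) - harmonic n) atTop (𝓝 (Real.log 2)) := by
  have h1 := Real.tendsto_harmonic_sub_log
  have h2 := h1.comp (tendsto_id.const_mul_atTop' (two_pos : 0 < 2))
  have h3 := (h2.sub h1).add_const (Real.log 2)
  rw [sub_self, zero_add] at h3
  refine h3.congr' ?_
  filter_upwards [eventually_gt_atTop 0] with n hn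
  have : (n : ℝ) ≠ 0 := by positivity
  simp only [Function.comp_apply, id]
  push_cast
  rw [Real.log_mul two_ne_zero this]
  ring

theorem tendsto_harmonic_add_sub_harmonic (p : ℕ) :
    Tendsto (fun K : ℕ => (harmonic (K + p) : ℝ) - harmonic K) atTop (𝓝 0) := by
  induction p with
  | zero => simp
  | succ p ih =>
    have h0 := (tendsto_one_div_add_atTop_nhds_zero_nat (𝕜 := ℝ)).comp (tendsto_add_atTop_nat p)
    have h1 := ih.add h0
    rw [add_zero] at h1
    refine h1.congr fun K => ?_
    rw [← add_assoc, cast_harmonic_succ]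
    simp only [Function.comp_apply, one_div]
    ring

/-- The alternating series test gives a limit, and the even subsequence `H_{2n} - H_n` identifies
it. -/
theorem tendsto_altHarmonic : Tendsto altHarmonic atTop (𝓝 (Real.log 2)) := by
  have hanti : Antitone fun n : ℕ => ((n : ℝ) + 1)⁻¹ := fun a b hab => by
    dsimp only
    gcongr
  have h0 : Tendsto (fun n : ℕ => ((n : ℝ) + 1)⁻¹) atTop (𝓝 0) := by
    simpa using tendsto_one_div_add_atTop_nhds_zero_nat (𝕜 := ℝ)
  obtain ⟨l, hl⟩ := hanti.tendsto_alternating_series_of_tendsto_zero h0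
  have hl' : Tendsto altHarmonic atTop (𝓝 l) := hl
  have h1 := hl'.comp (tendsto_id.const_mul_atTop' (two_pos : 0 < 2))
  have h2 := tendsto_harmonic_two_mul_sub_harmonic
  have h3 : l = Real.log 2 := tendsto_nhds_unique
    (h1.congr fun n => altHarmonic_two_mul n) h2
  rwa [← h3]

/-- Split at `n = m`, where the term is `0⁻¹ = 0`, and reflect the lower part. The hypothesis `x ^ 2
= 1` covers both the plain and the alternating case. -/
theorem sum_pow_mul_inv_sub {x : ℝ} (hx : x ^ 2 = 1) (m K : ℕ) :
    ∑ n ∈ range (m + 1 + K), x ^ n * ((n : ℝ) - m)⁻¹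
      = x ^ (m + 1) * (∑ j ∈ range K, x ^ j * ((j : ℝ) + 1)⁻¹
        - ∑ j ∈ range m, x ^ j * ((j : ℝ) + 1)⁻¹) := by
  rw [sum_range_add, sum_range_succ, ← sum_range_reflect, mul_sub, mul_sum, mul_sum, sub_self,
    inv_zero, mul_zero, add_zero, add_comm, sub_eq_add_neg, ← sum_neg_distrib]
  congr 1
  · refine sum_congr rfl fun j _ => ?_
    push_cast
    rw [pow_add, show (m : ℝ) + 1 + j - m = j + 1 by ring, mul_assoc]
  · refine sum_congr rfl fun j hj => ?_
    have hj' := mem_range.1 hj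
    have h1 : ((m - 1 - j : ℕ) : ℝ) - m = -(j + 1) := by
      have : ((m - 1 - j : ℕ) : ℝ) + (j + 1) = m := by
        exact_mod_cast (by omega : m - 1 - j + (j + 1) = m)
      linarith
    have h2 : x ^ (m + 1) * x ^ j = x ^ (m - 1 - j) := by
      rw [← pow_add, show m + 1 + j = m - 1 - j + 2 * (j + 1) by omega, pow_add, pow_mul, hx,
        one_pow, mul_one]
    rw [h1, ← mul_assoc, h2, inv_neg, mul_neg]

theorem tendsto_sum_inv_mul_inv_sub_odd (m : ℕ) :
    Tendsto (fun K => ∑ n ∈ range (m + 1 + K), (1 : ℝ) * (((2 * n + 1 : ℝ))⁻¹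
      * ((2 * n + 1 : ℝ) - (2 * m + 1))⁻¹)) atTop
      (𝓝 ((2 * m + 1 : ℝ)⁻¹ * ((2 * m + 1 : ℝ)⁻¹ - harmonic m / 2 - Real.log 2))) := by
  have hodd : ∀ N : ℕ, ∑ n ∈ range N, (2 * n + 1 : ℝ)⁻¹ = harmonic (2 * N) - harmonic N / 2 := by
    intro N
    induction N with
    | zero => simp
    | succ N ih =>
      rw [sum_range_succ, ih, show 2 * (N + 1) = 2 * N + 1 + 1 by ring, cast_harmonic_succ,
        cast_harmonic_succ, cast_harmonic_succ]
      push_cast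
      rw [show (2 * N + 1 : ℝ) + 1 = 2 * (N + 1) by ring, mul_inv]
      ring
  have hsum : ∀ K, ∑ n ∈ range (m + 1 + K), (1 : ℝ) * (((2 * n + 1 : ℝ))⁻¹
      * ((2 * n + 1 : ℝ) - (2 * m + 1))⁻¹)
      = (2 * m + 1 : ℝ)⁻¹ * ((2 * m + 1 : ℝ)⁻¹ - harmonic m / 2
        - ((harmonic (2 * (K + (m + 1))) : ℝ) - harmonic (K + (m + 1)))
        - ((harmonic (K + (m + 1)) : ℝ) - harmonic K) / 2) := by
    intro K
    have h1 := sum_pow_mul_inv_sub (x := 1) (one_pow 2) m K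
    simp only [one_pow, one_mul, ← cast_harmonic_eq_sum] at h1
    have h2 := hodd (m + 1 + K)
    -- Partial fractions fail at `n = m`, where the left side is 0; the `if` restores equality
    -- there.
    have h3 : ∀ n ∈ range (m + 1 + K), (1 : ℝ) * (((2 * n + 1 : ℝ))⁻¹
        * ((2 * n + 1 : ℝ) - (2 * m + 1))⁻¹) = (2 * m + 1 : ℝ)⁻¹ * (((n : ℝ) - m)⁻¹ / 2
          - (2 * n + 1 : ℝ)⁻¹ + if n = m then (2 * n + 1 : ℝ)⁻¹ else 0) := by
      intro n _
      have hn : (2 * n + 1 : ℝ) ≠ 0 := by positivity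
      have hm : (2 * m + 1 : ℝ) ≠ 0 := by positivity
      split_ifs with h
      · subst h; simp
      · have h4 : (n : ℝ) - m ≠ 0 := sub_ne_zero.2 (by exact_mod_cast h)
        rw [show (2 * n + 1 : ℝ) - (2 * m + 1) = 2 * (n - m) by ring]
        field_simp
        ring
    rw [sum_congr rfl h3, ← mul_sum, sum_add_distrib, sum_sub_distrib, ← sum_div, h1, h2,
      sum_ite_eq', if_pos (mem_range.2 (by omega)), add_comm K]
    ring
  have hA := tendsto_harmonic_add_sub_harmonic (m + 1)
  have hB := tendsto_harmonic_two_mul_sub_harmonic.comp (tendsto_add_atTop_nat (m + 1))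
  have hC := ((hB.const_sub ((2 * m + 1 : ℝ)⁻¹ - harmonic m / 2)).sub
    (hA.div_const 2)).const_mul (2 * m + 1 : ℝ)⁻¹
  rw [zero_div, sub_zero] at hC
  exact hC.congr fun K => (hsum K).symm

theorem tendsto_sum_neg_one_pow_mul_inv_mul_inv_sub (m : ℕ) :
    Tendsto (fun K => ∑ n ∈ range (m + 1 + K), (-1 : ℝ) ^ n * (((n + 1 : ℝ))⁻¹
      * ((n + 1 : ℝ) - (m + 1))⁻¹)) atTop
      (𝓝 ((m + 1 : ℝ)⁻¹ * ((-1) ^ m * (altHarmonic m - Real.log 2 + (m + 1 : ℝ)⁻¹)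
        - Real.log 2))) := by
  have hsum : ∀ K, ∑ n ∈ range (m + 1 + K), (-1 : ℝ) ^ n * (((n + 1 : ℝ))⁻¹
      * ((n + 1 : ℝ) - (m + 1))⁻¹)
      = (m + 1 : ℝ)⁻¹ * ((-1) ^ m * (altHarmonic m - altHarmonic K + (m + 1 : ℝ)⁻¹)
        - altHarmonic (K + (m + 1))) := by
    intro K
    have h1 := sum_pow_mul_inv_sub (x := -1) (by norm_num) m K
    have h3 : ∀ n ∈ range (m + 1 + K), (-1 : ℝ) ^ n * (((n + 1 : ℝ))⁻¹
        * ((n + 1 : ℝ) - (m + 1))⁻¹) = (m + 1 : ℝ)⁻¹ * ((-1) ^ n * ((n : ℝ) - m)⁻¹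
          - (-1) ^ n * (n + 1 : ℝ)⁻¹ + if n = m then (-1) ^ n * (n + 1 : ℝ)⁻¹ else 0) := by
      intro n _
      have hn : (n + 1 : ℝ) ≠ 0 := by positivity
      have hm : (m + 1 : ℝ) ≠ 0 := by positivity
      split_ifs with h
      · subst h; simp
      · have h4 : (n : ℝ) - m ≠ 0 := sub_ne_zero.2 (by exact_mod_cast h)
        rw [show (n + 1 : ℝ) - (m + 1) = n - m by ring]
        field_simp
        ring
    rw [sum_congr rfl h3, ← mul_sum, sum_add_distrib, sum_sub_distrib, h1,
      sum_ite_eq', if_pos (mem_range.2 (by omega)), add_comm K]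
    simp only [altHarmonic]
    ring
  have hB := tendsto_altHarmonic.comp (tendsto_add_atTop_nat (m + 1))
  have hC := (((((tendsto_altHarmonic.const_sub (altHarmonic m)).add_const
    (m + 1 : ℝ)⁻¹)).const_mul ((-1) ^ m)).sub hB).const_mul (m + 1 : ℝ)⁻¹
  exact hC.congr fun K => (hsum K).symm

/-- Induction on `m`: in the sum of the expressions for `m` and `m + 1`, the odd and even
denominators interleave into harmonic numbers, with limit `log 2 - 1 / (2 (m + 2))`. -/
theorem tendsto_sum_inv_sub_inv (m : ℕ) :
    Tendsto (fun K => ∑ i ∈ range K, ((m + 3 + 2 * i : ℝ)⁻¹ - (2 * (m + 2 + i) : ℝ)⁻¹)) atTop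
      (𝓝 ((1 + (-1) ^ m) / 2 * Real.log 2 - (-1) ^ m / 2 * altHarmonic (m + 1))) := by
  induction m with
  | zero =>
    have hsum : ∀ K, ∑ i ∈ range K, ((((0 : ℕ) : ℝ) + 3 + 2 * i : ℝ)⁻¹
        - (2 * (((0 : ℕ) : ℝ) + 2 + i) : ℝ)⁻¹) = altHarmonic (2 * (K + 1)) - 1 / 2 := by
      intro K
      induction K with
      | zero => norm_num [altHarmonic, sum_range_succ]
      | succ K ih =>
        have h1 : ((-1 : ℝ) ^ (2 * (K + 1))) = 1 := by rw [pow_mul, neg_one_sq, one_pow]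
        rw [sum_range_succ, ih, show 2 * (K + 1 + 1) = 2 * (K + 1) + 1 + 1 by ring,
          altHarmonic_succ, altHarmonic_succ, pow_succ, h1]
        push_cast
        rw [show (0 + 3 + 2 * K : ℝ) = 2 * (K + 1) + 1 by ring,
          show (2 * (0 + 2 + K) : ℝ) = 2 * (K + 1) + 1 + 1 by ring]
        ring
    have h1 := (tendsto_altHarmonic.comp ((tendsto_id.const_mul_atTop' (two_pos : 0 < 2)).comp
      (tendsto_add_atTop_nat 1))).sub_const (1 / 2)
    refine (h1.congr fun K => (hsum K).symm).trans_eq ?_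
    norm_num [altHarmonic]
  | succ m ih =>
    have hH : ∀ p K : ℕ, ∑ i ∈ range K, ((p : ℝ) + i + 1)⁻¹ = harmonic (p + K) - harmonic p := by
      intro p K
      induction K with
      | zero => simp
      | succ K ih => rw [sum_range_succ, ih, ← add_assoc, cast_harmonic_succ]; push_cast; ring
    have h2 : ∀ K : ℕ, ∑ i ∈ range K, ((m + 3 + 2 * i : ℝ)⁻¹ + (m + 4 + 2 * i : ℝ)⁻¹)
        = harmonic (m + 2 + 2 * K) - harmonic (m + 2) := by
      intro K
      induction K with
      | zero => simp
      | succ K ih =>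
        rw [sum_range_succ, ih, show m + 2 + 2 * (K + 1) = m + 2 + 2 * K + 1 + 1 by ring,
          cast_harmonic_succ (m + 2 + 2 * K + 1), cast_harmonic_succ (m + 2 + 2 * K)]
        push_cast
        rw [show (m + 3 + 2 * K : ℝ) = m + 2 + 2 * K + 1 by ring,
          show (m + 4 + 2 * K : ℝ) = m + 2 + 2 * K + 1 + 1 by ring]
        ring
    have h3 : ∀ K : ℕ, ∑ i ∈ range K, ((((m + 1 : ℕ) : ℝ) + 3 + 2 * i : ℝ)⁻¹
        - (2 * (((m + 1 : ℕ) : ℝ) + 2 + i) : ℝ)⁻¹)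
        = ((harmonic (2 * K) : ℝ) - harmonic K)
          + ((harmonic (2 * K + (m + 2)) : ℝ) - harmonic (2 * K))
          - ((harmonic (K + (m + 1)) : ℝ) - harmonic K) / 2
          - ((harmonic (K + (m + 2)) : ℝ) - harmonic K) / 2
          - (m + 2 : ℝ)⁻¹ / 2
          - ∑ i ∈ range K, ((m + 3 + 2 * i : ℝ)⁻¹ - (2 * (m + 2 + i) : ℝ)⁻¹) := by
      intro K
      have h4 : ∀ i ∈ range K, ((((m + 1 : ℕ) : ℝ) + 3 + 2 * i : ℝ)⁻¹
          - (2 * (((m + 1 : ℕ) : ℝ) + 2 + i) : ℝ)⁻¹)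
          = ((m + 3 + 2 * i : ℝ)⁻¹ + (m + 4 + 2 * i : ℝ)⁻¹) - (((m + 1 : ℕ) : ℝ) + i + 1)⁻¹ / 2
            - (((m + 2 : ℕ) : ℝ) + i + 1)⁻¹ / 2
            - ((m + 3 + 2 * i : ℝ)⁻¹ - (2 * (m + 2 + i) : ℝ)⁻¹) := by
        intro i _
        push_cast
        rw [mul_inv, mul_inv, show (m + 1 + 3 + 2 * i : ℝ) = m + 4 + 2 * i by ring,
          show (m + 1 + 2 + i : ℝ) = m + 2 + i + 1 by ring,
          show (m + 1 + i + 1 : ℝ) = m + 2 + i by ring]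
        ring
      have h5 := cast_harmonic_succ (m + 1)
      push_cast at h5
      rw [sum_congr rfl h4, sum_sub_distrib, sum_sub_distrib, sum_sub_distrib, h2, ← sum_div,
        ← sum_div, hH, hH, add_comm K, add_comm K, add_comm (2 * K), h5,
        show (m + 1 + 1 : ℝ) = m + 2 by ring]
      ring
    have hA := tendsto_harmonic_add_sub_harmonic
    have hB := (hA (m + 2)).comp (tendsto_id.const_mul_atTop' (two_pos : 0 < 2))
    have hC := ((((tendsto_harmonic_two_mul_sub_harmonic.add hB).sub ((hA (m + 1)).div_const 2)).sub
      ((hA (m + 2)).div_const 2)).sub_const ((m + 2 : ℝ)⁻¹ / 2)).sub ih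
    refine (hC.congr fun K => (h3 K).symm).trans_eq ?_
    rw [altHarmonic_succ (m + 1)]
    congr 1
    push_cast
    rw [pow_succ, show (m + 1 + 1 : ℝ) = m + 2 by ring]
    have hsq : ((-1 : ℝ) ^ m) ^ 2 = 1 := by rw [← pow_mul, mul_comm, pow_mul, neg_one_sq, one_pow]
    linear_combination ((m + 2 : ℝ)⁻¹ / 2) * hsq

/-! ### Zeta values over all, odd and signed integers -/

/-- The real number `ζ(k) = ∑_{n ≥ 1} n^{-k}`. -/
noncomputable def realZeta (k : ℕ) : ℝ := ∑' n : ℕ, ((n : ℝ) + 1)⁻¹ ^ k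

theorem hasSum_realZeta {k : ℕ} (hk : 2 ≤ k) :
    HasSum (fun n : ℕ => ((n : ℝ) + 1)⁻¹ ^ k) (realZeta k) := by
  refine Summable.hasSum ?_
  have h := (summable_nat_add_iff 1).2 (Real.summable_nat_pow_inv.2 (by omega : 1 < k))
  simpa [inv_pow] using h

theorem riemannZeta_natCast_eq_realZeta {k : ℕ} (hk : 2 ≤ k) :
    riemannZeta (k : ℂ) = (realZeta k : ℂ) := by
  have h := zeta_eq_tsum_one_div_nat_add_one_cpow (s := (k : ℂ))
    (by rw [Complex.natCast_re]; exact_mod_cast hk)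
  rw [h, realZeta, Complex.ofReal_tsum]
  refine tsum_congr fun n => ?_
  rw [Complex.cpow_natCast]
  push_cast
  rw [inv_pow, one_div]

theorem hasSum_realZeta_odd {k : ℕ} (hk : 2 ≤ k) :
    HasSum (fun n : ℕ => if Odd n then ((n : ℝ) + 1)⁻¹ ^ k else 0) (2⁻¹ ^ k * realZeta k) := by
  have hi : Function.Injective fun i : ℕ => 2 * i + 1 := fun a b h => by
    dsimp only at h
    omega
  refine (hi.hasSum_iff ?_).1 ?_
  · intro x hx
    refine if_neg fun ⟨y, hy⟩ => hx ⟨y, hy.symm⟩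
  · refine ((hasSum_realZeta hk).mul_left (2⁻¹ ^ k)).congr_fun ?_
    intro i
    have : Odd (2 * i + 1) := ⟨i, rfl⟩
    simp only [Function.comp_apply, if_pos this]
    rw [← mul_pow, ← mul_inv]
    push_cast
    ring_nf

theorem hasSum_inv_odd_pow {k : ℕ} (hk : 2 ≤ k) :
    HasSum (fun n : ℕ => (2 * (n : ℝ) + 1)⁻¹ ^ k) ((1 - 2⁻¹ ^ k) * realZeta k) := by
  have hi : Function.Injective fun i : ℕ => 2 * i := fun a b h => by
    dsimp only at h
    omega
  have h := (hasSum_realZeta hk).sub (hasSum_realZeta_odd hk)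
  rw [← one_sub_mul, ← hi.hasSum_iff] at h
  · refine h.congr_fun fun n => ?_
    have : ¬ Odd (2 * n) := by simp
    simp [this]
  · intro x hx
    have : Odd x := by
      rw [← Nat.not_even_iff_odd]
      rintro ⟨y, hy⟩
      exact hx ⟨y, by dsimp only; omega⟩
    simp [this]

theorem hasSum_neg_one_pow_mul_inv_pow {k : ℕ} (hk : 2 ≤ k) :
    HasSum (fun n : ℕ => (-1 : ℝ) ^ n * ((n : ℝ) + 1)⁻¹ ^ k)
      ((1 - 2 * 2⁻¹ ^ k) * realZeta k) := by
  have h := (hasSum_realZeta hk).sub ((hasSum_realZeta_odd hk).mul_left 2)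
  rw [← mul_assoc, ← one_sub_mul] at h
  refine h.congr_fun fun n => ?_
  split_ifs with hn
  · rw [hn.neg_one_pow]; ring
  · rw [(Nat.not_odd_iff_even.1 hn).neg_one_pow]; ring

/-! ### The harmonic series over odd denominators -/

theorem hasSum_harmonic_mul_inv_odd_pow (q : ℕ) :
    HasSum (fun n : ℕ => (harmonic n : ℝ) * (2 * (n : ℝ) + 1)⁻¹ ^ (q + 3))
      ((q + 3) * ((1 - 2⁻¹ ^ (q + 4)) * realZeta (q + 4))
        - 2 * Real.log 2 * ((1 - 2⁻¹ ^ (q + 3)) * realZeta (q + 3))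
        - ∑ i ∈ range (q + 1), ((1 - 2⁻¹ ^ (i + 2)) * realZeta (i + 2))
            * ((1 - 2⁻¹ ^ (q - i + 2)) * realZeta (q - i + 2))) := by
  have h1 := hasSum_inv_pow_mul_of_tendsto q (u := fun n => 2 * (n : ℝ) + 1) (ε := fun _ => 1)
    (L := fun i => (1 - 2⁻¹ ^ (i + 2)) * realZeta (i + 2))
    (fun n => by have : (0 : ℝ) ≤ n := n.cast_nonneg
                 linarith)
    (fun m n hmn => by
      have h : (1 : ℝ) ≤ |(n : ℝ) - m| := by
        have : (1 : ℤ) ≤ |(n : ℤ) - m| := Int.one_le_abs (by omega)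
        exact_mod_cast this
      rw [show 2 * (n : ℝ) + 1 - (2 * m + 1) = 2 * (n - m) by ring, abs_mul, abs_two]
      linarith)
    (fun _ => abs_one) (fun i _ => by simpa using hasSum_inv_odd_pow (k := i + 2) (by omega))
    (hasSum_inv_odd_pow (by omega)) (fun m => tendsto_sum_inv_mul_inv_sub_odd m)
  -- Solve for the `H_n / 2` part of the inner sum, then double.
  have h2 := (((hasSum_inv_odd_pow (k := q + 4) (by omega)).sub
    ((hasSum_inv_odd_pow (k := q + 3) (by omega)).mul_left (Real.log 2))).sub h1).mul_left 2
  have hval : ∀ S a b x : ℝ, 2 * (a - x * b - (S - (q + 1) * a) / 2)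
      = (q + 3) * a - 2 * x * b - S := fun S a b x => by ring
  rw [hval] at h2
  exact h2.congr_fun fun n => by ring

/-! ### The weighted sum of double zeta values -/

theorem hasSum_doubleZetaTerm_fiber (a b n : ℕ) :
    HasSum (fun m : ℕ => if m ∈ Ico 1 n then (n : ℝ)⁻¹ ^ a * (m : ℝ)⁻¹ ^ b else 0)
      (doubleZetaTerm a b n) := by
  have h := hasSum_sum_of_ne_finset_zero (L := .unconditional ℕ) (s := Ico 1 n)
    (f := fun m : ℕ => if m ∈ Ico 1 n then (n : ℝ)⁻¹ ^ a * (m : ℝ)⁻¹ ^ b else 0)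
    (fun m hm => if_neg hm)
  convert h using 1
  refine sum_congr rfl fun m hm => ?_
  rw [if_pos hm, one_div, mul_inv, inv_pow, inv_pow]

theorem summable_doubleZeta_prod {a b : ℕ} (ha : 2 ≤ a) (hb : 1 ≤ b) :
    Summable fun p : ℕ × ℕ =>
      if p.2 ∈ Ico 1 p.1 then (p.1 : ℝ)⁻¹ ^ a * (p.2 : ℝ)⁻¹ ^ b else 0 := by
  refine Summable.of_nonneg_of_le (fun p => ?_) (fun p => ?_)
    (summable_prod_inv_mul_sqrt.mul_left 2)
  · split_ifs <;> positivity
  · obtain ⟨n, m⟩ := p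
    dsimp only
    split_ifs with h
    · obtain ⟨h1, h2⟩ := mem_Ico.1 h
      have hm : (1 : ℝ) ≤ m := by exact_mod_cast h1
      have hn : (m : ℝ) ≤ n := by exact_mod_cast h2.le
      have h3 := inv_sq_mul_mul_le (x := n) (y := m) (d := 1) (by linarith) hm le_rfl (by linarith)
      refine le_trans ?_ h3
      rw [mul_one, mul_inv, ← inv_pow]
      have h4 : (n : ℝ)⁻¹ ^ a ≤ (n : ℝ)⁻¹ ^ 2 :=
        pow_le_pow_of_le_one (by positivity) (inv_le_one_of_one_le₀ (by linarith)) ha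
      have h5 : (m : ℝ)⁻¹ ^ b ≤ (m : ℝ)⁻¹ ^ 1 :=
        pow_le_pow_of_le_one (by positivity) (inv_le_one_of_one_le₀ (by linarith)) hb
      rw [pow_one] at h5
      gcongr
    · positivity

theorem hasSum_doubleZeta_prod {a b : ℕ} (ha : 2 ≤ a) (hb : 1 ≤ b) :
    HasSum (fun p : ℕ × ℕ => if p.2 ∈ Ico 1 p.1 then (p.1 : ℝ)⁻¹ ^ a * (p.2 : ℝ)⁻¹ ^ b else 0)
      (doubleZeta a b) := by
  have h := (summable_doubleZeta_prod ha hb).hasSum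
  have h1 := h.prod_fiberwise (fun n => hasSum_doubleZetaTerm_fiber a b n)
  rwa [← h1.tsum_eq] at h

theorem summable_doubleZetaTerm {a b : ℕ} (ha : 2 ≤ a) (hb : 1 ≤ b) :
    Summable (doubleZetaTerm a b) :=
  ((summable_doubleZeta_prod ha hb).hasSum.prod_fiberwise
    (fun n => hasSum_doubleZetaTerm_fiber a b n)).summable

theorem sum_inv_two_mul_pow_mul_inv_pow (q : ℕ) {x y : ℝ} (hx : x ≠ 0) (hy : y ≠ 0)
    (hxy : 2 * x ≠ y) :
    ∑ i ∈ range (q + 2), 2 * 2⁻¹ ^ (i + 2) * (x⁻¹ ^ (i + 2) * y⁻¹ ^ (q + 2 - i))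
      = -2 * ((2 * x)⁻¹ ^ (q + 3) * (2 * x - y)⁻¹)
        + 2 * y⁻¹ ^ (q + 2) * ((2 * x)⁻¹ * (2 * x - y)⁻¹) := by
  have h := geom_sum₂_mul (2 * x)⁻¹ y⁻¹ (q + 2)
  have h1 : 2 * x - y ≠ 0 := sub_ne_zero.2 hxy
  have h2 : (2 * x)⁻¹ - y⁻¹ = -((2 * x - y) * ((2 * x)⁻¹ * y⁻¹)) := by field_simp; ring
  have h3 : ∑ i ∈ range (q + 2), 2 * 2⁻¹ ^ (i + 2) * (x⁻¹ ^ (i + 2) * y⁻¹ ^ (q + 2 - i))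
      = (∑ i ∈ range (q + 2), (2 * x)⁻¹ ^ i * y⁻¹ ^ (q + 2 - 1 - i))
        * (2 * (2 * x)⁻¹ ^ 2 * y⁻¹) := by
    rw [Finset.sum_mul]
    refine sum_congr rfl fun i hi => ?_
    have hi' := mem_range.1 hi
    rw [show q + 2 - i = q + 2 - 1 - i + 1 by omega, pow_succ y⁻¹, mul_inv, mul_pow, mul_pow,
      pow_add, pow_add]
    ring
  rw [h2] at h
  rw [h3]
  generalize ∑ i ∈ range (q + 2), (2 * x)⁻¹ ^ i * y⁻¹ ^ (q + 2 - 1 - i) = S at *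
  have h4 : S * ((2 * x)⁻¹ * y⁻¹) = (y⁻¹ ^ (q + 2) - (2 * x)⁻¹ ^ (q + 2)) * (2 * x - y)⁻¹ := by
    rw [← neg_sub ((2 * x)⁻¹ ^ (q + 2)), ← h, mul_neg, neg_neg, mul_assoc, mul_right_comm,
      mul_inv_cancel₀ h1, one_mul]
  calc S * (2 * (2 * x)⁻¹ ^ 2 * y⁻¹) = S * ((2 * x)⁻¹ * y⁻¹) * (2 * (2 * x)⁻¹) := by ring
    _ = _ := by rw [h4]; ring

/-- The denominators run through `n + 2, …, 2n + 1`, so the sum is `H_{2n+1} - H_{n+1}`. -/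
theorem sum_Ico_inv_two_mul_sub (n : ℕ) :
    ∑ m ∈ Ico 1 (n + 1), (2 * ((n + 1 : ℕ) : ℝ) - m)⁻¹
      = altHarmonic (2 * n + 1) - ((n : ℝ) + 1)⁻¹ := by
  have h1 := cast_harmonic_eq_sum (n + 1 + n)
  rw [sum_range_add, ← cast_harmonic_eq_sum, show n + 1 + n = 2 * n + 1 by ring] at h1
  rw [altHarmonic_succ, altHarmonic_two_mul, pow_mul, neg_one_sq, one_pow, one_mul]
  rw [cast_harmonic_succ, cast_harmonic_succ] at h1
  have h2 : ∑ m ∈ Ico 1 (n + 1), (2 * ((n + 1 : ℕ) : ℝ) - m)⁻¹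
      = ∑ x ∈ range n, (((n + 1 + x : ℕ) : ℝ) + 1)⁻¹ := by
    rw [sum_Ico_eq_sum_range, Nat.add_sub_cancel, ← sum_range_reflect]
    refine sum_congr rfl fun j hj => ?_
    have hj' := mem_range.1 hj
    have h3 : ((n - 1 - j : ℕ) : ℝ) + (j + 1) = n := by
      exact_mod_cast (by omega : n - 1 - j + (j + 1) = n)
    congr 1
    push_cast
    linarith
  rw [h2]
  push_cast at h1 ⊢
  linarith

theorem tendsto_sum_inv_mul_inv_two_mul_sub (q m : ℕ) :
    Tendsto (fun K => ∑ i ∈ range K, 2 * ((m : ℝ) + 1)⁻¹ ^ (q + 2)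
      * ((2 * ((m + 2 + i : ℕ) : ℝ))⁻¹ * (2 * ((m + 2 + i : ℕ) : ℝ) - (m + 1))⁻¹)) atTop
      (𝓝 (((m : ℝ) + 1)⁻¹ ^ (q + 3) *
        ((1 + (-1) ^ m) * Real.log 2 - (-1) ^ m * altHarmonic (m + 1)))) := by
  have h := (tendsto_sum_inv_sub_inv m).const_mul (2 * ((m : ℝ) + 1)⁻¹ ^ (q + 3))
  refine (h.congr fun K => ?_).trans_eq ?_
  · rw [mul_sum]
    refine sum_congr rfl fun i _ => ?_
    push_cast
    rw [show 2 * ((m : ℝ) + 2 + i) - (m + 1) = m + 3 + 2 * i by ring, pow_succ]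
    have h1 : (m : ℝ) + 1 ≠ 0 := by positivity
    have h2 : (m : ℝ) + 2 + i ≠ 0 := by positivity
    have h3 : (m : ℝ) + 3 + 2 * i ≠ 0 := by positivity
    have h4 : ((m : ℝ) + 3 + 2 * i)⁻¹ - (2 * (m + 2 + i) : ℝ)⁻¹
        = (m + 1) * ((2 * (m + 2 + i) : ℝ)⁻¹ * ((m : ℝ) + 3 + 2 * i)⁻¹) := by
      field_simp
      ring
    rw [h4, ← mul_assoc, mul_assoc 2, mul_assoc (_ ^ _), mul_assoc 2, mul_assoc (_ ^ _),
      inv_mul_cancel₀ h1, one_mul, mul_assoc]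
  · congr 1
    ring

theorem hasSum_inv_two_mul_fiber (q n : ℕ) :
    HasSum (fun m : ℕ => if m ∈ Ico 1 (n + 1) then
        -2 * ((2 * ((n + 1 : ℕ) : ℝ))⁻¹ ^ (q + 3) * (2 * ((n + 1 : ℕ) : ℝ) - m)⁻¹) else 0)
      (-2 * (2 * ((n : ℝ) + 1))⁻¹ ^ (q + 3) * (altHarmonic (2 * n + 1) - ((n : ℝ) + 1)⁻¹)) := by
  have h := hasSum_sum_of_ne_finset_zero (L := .unconditional ℕ) (s := Ico 1 (n + 1))
    (f := fun m : ℕ => if m ∈ Ico 1 (n + 1) then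
      -2 * ((2 * ((n + 1 : ℕ) : ℝ))⁻¹ ^ (q + 3) * (2 * ((n + 1 : ℕ) : ℝ) - m)⁻¹) else 0)
    (fun m hm => if_neg hm)
  convert h using 1
  rw [← sum_Ico_inv_two_mul_sub, mul_sum]
  refine sum_congr rfl fun m hm => ?_
  rw [if_pos hm]
  push_cast
  ring

theorem summable_inv_mul_inv_two_mul_sub (q : ℕ) :
    Summable fun p : ℕ × ℕ => if p.2 ∈ Ico 1 p.1 then
      2 * (p.2 : ℝ)⁻¹ ^ (q + 2) * ((2 * (p.1 : ℝ))⁻¹ * (2 * (p.1 : ℝ) - p.2)⁻¹) else 0 := by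
  have h2 := Real.summable_nat_pow_inv.2 (one_lt_two)
  refine Summable.of_norm_bounded ((h2.mul_of_nonneg h2 (fun _ => by positivity)
    (fun _ => by positivity)).mul_left 2) ?_
  rintro ⟨n, m⟩
  dsimp only
  split_ifs with h
  · obtain ⟨h3, h4⟩ := mem_Ico.1 h
    have hm : (1 : ℝ) ≤ m := by exact_mod_cast h3
    have hn : (m : ℝ) ≤ n := by exact_mod_cast h4.le
    have hn0 : (0 : ℝ) < n := by linarith
    have hd : (0 : ℝ) < 2 * n - m := by linarith
    rw [Real.norm_of_nonneg (by positivity)]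
    have h5 : (m : ℝ)⁻¹ ^ (q + 2) ≤ (m : ℝ)⁻¹ ^ 2 :=
      pow_le_pow_of_le_one (by positivity) (inv_le_one_of_one_le₀ hm) (by omega)
    have h6 : (2 * (n : ℝ))⁻¹ ≤ (n : ℝ)⁻¹ := inv_anti₀ hn0 (by linarith)
    have h7 : (2 * (n : ℝ) - m)⁻¹ ≤ (n : ℝ)⁻¹ := inv_anti₀ hn0 (by linarith)
    calc 2 * (m : ℝ)⁻¹ ^ (q + 2) * ((2 * (n : ℝ))⁻¹ * (2 * (n : ℝ) - m)⁻¹)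
        ≤ 2 * (m : ℝ)⁻¹ ^ 2 * ((n : ℝ)⁻¹ * (n : ℝ)⁻¹) := by gcongr
      _ = _ := by rw [← inv_pow, ← inv_pow]; ring
  · rw [norm_zero]; positivity

theorem hasSum_inv_mul_inv_two_mul_sub_fiber (q m : ℕ)
    (hs : Summable fun n : ℕ => if m + 1 ∈ Ico 1 n then
      2 * ((m + 1 : ℕ) : ℝ)⁻¹ ^ (q + 2) * ((2 * (n : ℝ))⁻¹ * (2 * (n : ℝ) - ((m + 1 : ℕ) : ℝ))⁻¹)
        else 0) :
    HasSum (fun n : ℕ => if m + 1 ∈ Ico 1 n then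
      2 * ((m + 1 : ℕ) : ℝ)⁻¹ ^ (q + 2) * ((2 * (n : ℝ))⁻¹ * (2 * (n : ℝ) - ((m + 1 : ℕ) : ℝ))⁻¹)
        else 0) (((m : ℝ) + 1)⁻¹ ^ (q + 3) *
        ((1 + (-1) ^ m) * Real.log 2 - (-1) ^ m * altHarmonic (m + 1))) := by
  have hi : Function.Injective fun i : ℕ => m + 2 + i := fun a b h => by
    dsimp only at h
    omega
  have hz : ∀ n ∉ Set.range (fun i : ℕ => m + 2 + i), (if m + 1 ∈ Ico 1 n then
      2 * ((m + 1 : ℕ) : ℝ)⁻¹ ^ (q + 2) * ((2 * (n : ℝ))⁻¹ * (2 * (n : ℝ) - ((m + 1 : ℕ) : ℝ))⁻¹)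
        else 0) = 0 := by
    intro n hn
    refine if_neg fun h => hn ⟨n - (m + 2), ?_⟩
    have := (mem_Ico.1 h).2
    dsimp only
    omega
  have h1 := hs.comp_injective hi
  have h2 : HasSum _ _ := (hi.hasSum_iff hz).1 h1.hasSum
  convert h2 using 1
  refine tendsto_nhds_unique ((tendsto_sum_inv_mul_inv_two_mul_sub q m).congr fun K => ?_)
    h1.hasSum.tendsto_sum_nat
  refine sum_congr rfl fun i _ => ?_
  have : m + 1 ∈ Ico 1 (m + 2 + i) := mem_Ico.2 ⟨by omega, by omega⟩
  simp only [Function.comp_apply, if_pos this]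
  push_cast
  rfl

/-- The geometric sum splits the summand into `f`, summed first over the smaller index, and `g`,
summed first over the larger. Adding the alternating case of `hasSum_inv_pow_mul_of_tendsto` cancels
everything but a zeta series. -/
theorem sum_mul_doubleZeta_eq (q : ℕ) :
    ∑ i ∈ range (q + 2), 2 * 2⁻¹ ^ (i + 2) * doubleZeta (i + 2) (q + 2 - i)
      = 4 * (2⁻¹ ^ (q + 4) * realZeta (q + 4))
        - (∑ i ∈ range (q + 1), ((1 - 2 * 2⁻¹ ^ (i + 2)) * realZeta (i + 2))
            * ((1 - 2 * 2⁻¹ ^ (q - i + 2)) * realZeta (q - i + 2))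
          - (q + 1) * realZeta (q + 4)) / 2 := by
  set Z := ∑ i ∈ range (q + 2), 2 * 2⁻¹ ^ (i + 2) * doubleZeta (i + 2) (q + 2 - i) with hZ
  set f : ℕ × ℕ → ℝ := fun p => if p.2 ∈ Ico 1 p.1 then
    -2 * ((2 * (p.1 : ℝ))⁻¹ ^ (q + 3) * (2 * (p.1 : ℝ) - p.2)⁻¹) else 0 with hf
  set g : ℕ × ℕ → ℝ := fun p => if p.2 ∈ Ico 1 p.1 then
    2 * (p.2 : ℝ)⁻¹ ^ (q + 2) * ((2 * (p.1 : ℝ))⁻¹ * (2 * (p.1 : ℝ) - p.2)⁻¹) else 0 with hg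
  have htot : HasSum (fun p => f p + g p) Z := by
    have h1 : HasSum (fun p : ℕ × ℕ => ∑ i ∈ range (q + 2), 2 * 2⁻¹ ^ (i + 2) *
        (if p.2 ∈ Ico 1 p.1 then (p.1 : ℝ)⁻¹ ^ (i + 2) * (p.2 : ℝ)⁻¹ ^ (q + 2 - i) else 0)) Z :=
      hasSum_sum fun i hi => (hasSum_doubleZeta_prod (by omega)
        (by have := mem_range.1 hi; omega)).mul_left _
    refine h1.congr_fun fun p => ?_
    simp only [hf, hg]
    split_ifs with h
    · obtain ⟨h3, h4⟩ := mem_Ico.1 h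
      have h5 : (p.2 : ℝ) < p.1 := by exact_mod_cast h4
      have h6 : (0 : ℝ) < p.2 := by exact_mod_cast h3
      rw [sum_inv_two_mul_pow_mul_inv_pow q (by linarith) h6.ne' (by linarith)]
    · simp
  have hgs : Summable g := summable_inv_mul_inv_two_mul_sub q
  have hfs : Summable f := (htot.summable.sub hgs).congr fun p => add_sub_cancel_right _ _
  have hZfg : Z = (∑' p, f p) + ∑' p, g p := htot.unique (hfs.hasSum.add hgs.hasSum)
  have hF : HasSum (fun n : ℕ => -2 * (2 * ((n : ℝ) + 1))⁻¹ ^ (q + 3)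
      * (altHarmonic (2 * n + 1) - ((n : ℝ) + 1)⁻¹)) (∑' p, f p) := by
    have h1 := hfs.hasSum.prod_fiberwise fun n => (hfs.prod_factor n).hasSum
    -- The index 0 contributes an empty fibre and is dropped.
    rw [← hasSum_nat_add_iff' 1] at h1
    have h0 : ∑' m, f (0, m) = 0 := by simp [hf]
    rw [sum_range_one, h0, sub_zero] at h1
    refine h1.congr_fun fun n => ?_
    simp only [hf]
    exact (hasSum_inv_two_mul_fiber q n).tsum_eq.symm
  have hG : HasSum (fun m : ℕ => ((m : ℝ) + 1)⁻¹ ^ (q + 3) *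
        ((1 + (-1) ^ m) * Real.log 2 - (-1) ^ m * altHarmonic (m + 1))) (∑' p, g p) := by
    have hgs' : HasSum (fun p : ℕ × ℕ => g p.swap) (∑' p, g p) :=
      (Equiv.prodComm ℕ ℕ).hasSum_iff (f := g) |>.2 hgs.hasSum
    have h1 := hgs'.prod_fiberwise fun n => (hgs'.summable.prod_factor n).hasSum
    rw [← hasSum_nat_add_iff' 1] at h1
    have h0 : ∑' m, g (Prod.swap (0, m)) = 0 := by simp [hg]
    rw [sum_range_one, h0, sub_zero] at h1
    refine h1.congr_fun fun m => ?_
    have h2 := hgs'.summable.prod_factor (m + 1)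
    simp only [hg, Prod.swap] at h2 ⊢
    exact (hasSum_inv_mul_inv_two_mul_sub_fiber q m h2).tsum_eq.symm
  have hE := hasSum_inv_pow_mul_of_tendsto q (u := fun n => (n : ℝ) + 1) (ε := fun n => (-1) ^ n)
    (L := fun i => (1 - 2 * 2⁻¹ ^ (i + 2)) * realZeta (i + 2)) (fun n => le_rfl)
    (fun m n hmn => by
      have : (1 : ℤ) ≤ |(n : ℤ) - m| := Int.one_le_abs (by omega)
      rw [add_sub_add_right_eq_sub]
      exact_mod_cast this)
    (fun _ => abs_neg_one_pow _)
    (fun i _ => hasSum_neg_one_pow_mul_inv_pow (by omega))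
    (hasSum_realZeta (by omega)) (fun m => tendsto_sum_neg_one_pow_mul_inv_mul_inv_sub m)
  -- Reindexing by `m = 2n + 1` gives `2(n + 1) = m + 1`, which aligns this series with the other
  -- two.
  have hF' : HasSum (fun m : ℕ => if Odd m then
      -2 * ((m : ℝ) + 1)⁻¹ ^ (q + 3) * (altHarmonic m - 2 * ((m : ℝ) + 1)⁻¹) else 0)
      (∑' p, f p) := by
    have hi : Function.Injective fun i : ℕ => 2 * i + 1 := fun a b h => by
      dsimp only at h
      omega
    refine (hi.hasSum_iff ?_).1 ?_
    · intro x hx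
      exact if_neg fun ⟨y, hy⟩ => hx ⟨y, hy.symm⟩
    · refine hF.congr_fun fun i => ?_
      have : Odd (2 * i + 1) := ⟨i, rfl⟩
      simp only [Function.comp_apply, if_pos this]
      push_cast
      rw [show (2 * i + 1 + 1 : ℝ) = 2 * (i + 1) by ring, mul_inv, ← mul_assoc 2 2⁻¹,
        mul_inv_cancel₀ two_ne_zero, one_mul]
  -- Termwise, the total is `4 (m + 1)^{-(q+4)}` for odd `m` and 0 for even `m`.
  have hall := (hF'.add hG).add hE
  have hfin := (hasSum_realZeta_odd (k := q + 4) (by omega)).mul_left 4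
  have := hall.unique (hfin.congr_fun fun m => ?_)
  · linarith
  · have hsq : ((-1 : ℝ) ^ m) * (-1) ^ m = 1 := by rw [← mul_pow]; simp
    rw [altHarmonic_succ]
    split_ifs with hm
    · rw [hm.neg_one_pow]
      ring
    · rw [(Nat.not_odd_iff_even.1 hm).neg_one_pow]
      ring

/-! ### Folding the convolutions and passing to complex values -/

theorem sum_range_two_mul_add_one_of_symm {F : ℕ → ℝ} (r : ℕ)
    (h : ∀ i ≤ 2 * r, F (2 * r - i) = F i) :
    ∑ i ∈ range (2 * r + 1), F i = 2 * ∑ i ∈ range (r + 1), F i - F r := by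
  rw [show 2 * r + 1 = r + 1 + r by ring, sum_range_add,
    ← sum_range_reflect (fun x => F (r + 1 + x))]
  have h1 : ∑ i ∈ range r, F (r + 1 + (r - 1 - i)) = ∑ i ∈ range r, F i := by
    refine sum_congr rfl fun i hi => ?_
    have hi' := mem_range.1 hi
    rw [← h i (by omega)]
    congr 1
    omega
  rw [h1, sum_range_succ]
  ring

theorem sum_Icc_two_eq_sum_range {M : Type*} [AddCommMonoid M] (f : ℕ → M) (r : ℕ) :
    ∑ k ∈ Icc 2 (r + 2), f k = ∑ i ∈ range (r + 1), f (i + 2) := by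
  rw [← Finset.Ico_add_one_right_eq_Icc, sum_Ico_eq_sum_range]
  exact sum_congr rfl fun i _ => by rw [add_comm]

theorem riemannZeta_two_mul_sub_natCast {s k : ℕ} (h : k + 2 ≤ 2 * s) :
    riemannZeta (2 * (s : ℂ) - (k : ℂ)) = (realZeta (2 * s - k) : ℂ) := by
  rw [← riemannZeta_natCast_eq_realZeta (by omega), Nat.cast_sub (by omega)]
  push_cast
  rfl

theorem mainTheorem5 (s : ℕ) (hs : 2 ≤ s) :
    HasSum (fun n : ℕ => ((harmonic n : ℚ) : ℂ) / (2 * (n : ℂ) + 1) ^ (2 * s - 1))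
      ((1 - (4 : ℂ) ^ (-(s : ℤ))) * (2 * (s : ℂ) - 1) * riemannZeta (2 * (s : ℂ))
        - (2 - (4 : ℂ) ^ (1 - (s : ℤ))) * ((Real.log 2 : ℝ) : ℂ) * riemannZeta (2 * (s : ℂ) - 1)
        + (1 - (2 : ℂ) ^ (-(s : ℤ))) ^ 2 * riemannZeta (s : ℂ) ^ 2
        - ∑ k ∈ Finset.Icc 2 s,
            2 * (1 - (2 : ℂ) ^ (-(k : ℤ))) * (1 - (2 : ℂ) ^ ((k : ℤ) - 2 * (s : ℤ)))
              * riemannZeta (k : ℂ) * riemannZeta (2 * (s : ℂ) - (k : ℂ)))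
    ∧ (∀ j ∈ Finset.Icc 2 (2 * s - 1), Summable (doubleZetaTerm j (2 * s - j)))
    ∧ ∑ j ∈ Finset.Icc 2 (2 * s - 1),
          (2 : ℂ) ^ (1 - (j : ℤ)) * ((doubleZeta j (2 * s - j) : ℝ) : ℂ)
        = 1 / 2 * (1 - (2 : ℂ) ^ (1 - (s : ℤ))) ^ 2 * riemannZeta (s : ℂ) ^ 2
          + 1 / 2 * ((2 : ℂ) ^ (3 - 2 * (s : ℤ)) + 2 * (s : ℂ) - 3) * riemannZeta (2 * (s : ℂ))
          - ∑ k ∈ Finset.Icc 2 s,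
              ((2 : ℂ) ^ ((k : ℤ) - 1) - 1) * ((2 : ℂ) ^ (1 - (k : ℤ)) - (4 : ℂ) ^ (1 - (s : ℤ)))
                * riemannZeta (k : ℂ) * riemannZeta (2 * (s : ℂ) - (k : ℂ)) := by
  obtain ⟨r, rfl⟩ : ∃ r, s = r + 2 := ⟨s - 2, by omega⟩
  have h2s : riemannZeta (2 * ((r + 2 : ℕ) : ℂ)) = (realZeta (2 * r + 4) : ℂ) := by
    rw [← riemannZeta_natCast_eq_realZeta (by omega)]
    push_cast
    ring_nf
  have h2s1 : riemannZeta (2 * ((r + 2 : ℕ) : ℂ) - 1) = (realZeta (2 * r + 3) : ℂ) := by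
    rw [← riemannZeta_natCast_eq_realZeta (by omega)]
    push_cast
    ring_nf
  have hzs : riemannZeta ((r + 2 : ℕ) : ℂ) = (realZeta (r + 2) : ℂ) :=
    riemannZeta_natCast_eq_realZeta (by omega)
  have hzk : ∀ i ∈ range (r + 1), riemannZeta ((i + 2 : ℕ) : ℂ) = (realZeta (i + 2) : ℂ) :=
    fun i _ => riemannZeta_natCast_eq_realZeta (by omega)
  have hzk' : ∀ i ∈ range (r + 1), riemannZeta (2 * ((r + 2 : ℕ) : ℂ) - ((i + 2 : ℕ) : ℂ))
      = (realZeta (2 * r - i + 2) : ℂ) := by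
    intro i hi
    have := mem_range.1 hi
    rw [riemannZeta_two_mul_sub_natCast (by omega),
      show 2 * (r + 2) - (i + 2) = 2 * r - i + 2 by omega]
  have hneg : ∀ k : ℕ, (2 : ℂ) ^ (-(k : ℤ)) = 2⁻¹ ^ k := fun k => by
    rw [zpow_neg, zpow_natCast, inv_pow]
  have h4 : (4 : ℂ) ^ (1 - ((r + 2 : ℕ) : ℤ)) = 2 * 2⁻¹ ^ (2 * r + 3) := by
    rw [show (4 : ℂ) = 2 ^ (2 : ℤ) by norm_num, ← zpow_mul, ← hneg, mul_comm (2 : ℂ),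
      ← zpow_add_one₀ two_ne_zero]
    congr 1
  refine ⟨?_, ?_, ?_⟩
  · have h := hasSum_harmonic_mul_inv_odd_pow (2 * r)
    rw [sum_range_two_mul_add_one_of_symm] at h
    · have hc := Complex.hasSum_ofReal.2 h
      have h4s : (4 : ℂ) ^ (-((r + 2 : ℕ) : ℤ)) = 2⁻¹ ^ (2 * r + 4) := by
        rw [show (4 : ℂ) = 2 ^ (2 : ℤ) by norm_num, ← zpow_mul, ← hneg]
        congr 1
      rw [sum_Icc_two_eq_sum_range, h2s, h2s1, hzs, h4, h4s, hneg]
      have hsum : ∀ i ∈ range (r + 1), 2 * (1 - (2 : ℂ) ^ (-((i + 2 : ℕ) : ℤ)))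
          * (1 - (2 : ℂ) ^ (((i + 2 : ℕ) : ℤ) - 2 * ((r + 2 : ℕ) : ℤ)))
          * riemannZeta ((i + 2 : ℕ) : ℂ)
          * riemannZeta (2 * ((r + 2 : ℕ) : ℂ) - ((i + 2 : ℕ) : ℂ))
          = 2 * (((1 - 2⁻¹ ^ (i + 2)) * realZeta (i + 2))
            * ((1 - 2⁻¹ ^ (2 * r - i + 2)) * realZeta (2 * r - i + 2))) := by
        intro i hi
        have hi' := mem_range.1 hi
        have hpow : (2 : ℂ) ^ (((i + 2 : ℕ) : ℤ) - 2 * ((r + 2 : ℕ) : ℤ))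
            = 2⁻¹ ^ (2 * r - i + 2) := by
          rw [← hneg]
          congr 1
          omega
        rw [hzk i hi, hzk' i hi, hneg, hpow]
        ring
      rw [sum_congr rfl hsum, ← mul_sum]
      have hr : 2 * r - r = r := by omega
      push_cast [hr] at hc
      have hval : ∀ S a b x c : ℂ, (2 * r + 3) * a - 2 * x * b - (2 * S - c)
          = a * (2 * r + 3) - 2 * x * b + c - 2 * S := fun S a b x c => by ring
      rw [hval] at hc
      convert hc using 1
      · funext n
        rw [show 2 * (r + 2) - 1 = 2 * r + 3 by omega, div_eq_mul_inv, inv_pow]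
      · push_cast
        ring
    · intro i hi
      rw [show 2 * r - (2 * r - i) = i by omega, mul_comm]
  · intro j hj
    obtain ⟨h1, h2⟩ := mem_Icc.1 hj
    exact summable_doubleZetaTerm h1 (by omega)
  · have h := sum_mul_doubleZeta_eq (2 * r)
    -- The middle term `i = r`, counted twice by the folding, produces `ζ(s)^2`.
    rw [sum_range_two_mul_add_one_of_symm] at h
    · have hc := congrArg (fun x : ℝ => (x : ℂ)) h
      have hr : 2 * r - r = r := by omega
      push_cast [hr] at hc
      rw [show 2 * (r + 2) - 1 = 2 * r + 1 + 2 by omega, sum_Icc_two_eq_sum_range,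
        sum_Icc_two_eq_sum_range, h2s, hzs]
      have hpow1 : ∀ k : ℕ, (2 : ℂ) ^ (1 - (k : ℤ)) = 2 * 2⁻¹ ^ k := fun k => by
        rw [sub_eq_add_neg, zpow_add₀ two_ne_zero, zpow_one, hneg]
      have hpow3 : (2 : ℂ) ^ (3 - 2 * ((r + 2 : ℕ) : ℤ)) = 8 * 2⁻¹ ^ (2 * r + 4) := by
        rw [← hneg, show (8 : ℂ) = 2 ^ (3 : ℤ) by norm_num, ← zpow_add₀ two_ne_zero]
        congr 1
      have hL : ∀ i ∈ range (2 * r + 1 + 1), (2 : ℂ) ^ (1 - ((i + 2 : ℕ) : ℤ))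
          * ((doubleZeta (i + 2) (2 * (r + 2) - (i + 2)) : ℝ) : ℂ)
          = 2 * 2⁻¹ ^ (i + 2) * (doubleZeta (i + 2) (2 * r + 2 - i) : ℂ) := by
        intro i _
        rw [hpow1, show 2 * (r + 2) - (i + 2) = 2 * r + 2 - i by omega]
      have hR : ∀ i ∈ range (r + 1), ((2 : ℂ) ^ (((i + 2 : ℕ) : ℤ) - 1) - 1)
          * ((2 : ℂ) ^ (1 - ((i + 2 : ℕ) : ℤ)) - (4 : ℂ) ^ (1 - ((r + 2 : ℕ) : ℤ)))
          * riemannZeta ((i + 2 : ℕ) : ℂ)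
          * riemannZeta (2 * ((r + 2 : ℕ) : ℂ) - ((i + 2 : ℕ) : ℂ))
          = ((1 - 2 * 2⁻¹ ^ (i + 2)) * realZeta (i + 2))
            * ((1 - 2 * 2⁻¹ ^ (2 * r - i + 2)) * realZeta (2 * r - i + 2)) := by
        intro i hi
        have hi' := mem_range.1 hi
        have e1 : (2 : ℂ) ^ (((i + 2 : ℕ) : ℤ) - 1) = 2 ^ (i + 1) := by
          rw [← zpow_natCast]
          congr 1
          push_cast
          ring
        have e2 : (2 : ℂ)⁻¹ ^ (2 * r + 3) = 2⁻¹ ^ (i + 1) * 2⁻¹ ^ (2 * r - i + 2) := by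
          rw [← pow_add]
          congr 1
          omega
        have e3 : (2 : ℂ) ^ (i + 1) * 2⁻¹ ^ (i + 1) = 1 := by
          rw [← mul_pow, mul_inv_cancel₀ two_ne_zero, one_pow]
        rw [hzk i hi, hzk' i hi, h4, hpow1, e1, e2, pow_succ _ (i + 1)]
        linear_combination (1 - 2 * 2⁻¹ ^ (2 * r - i + 2)) * (realZeta (i + 2) : ℂ)
          * (realZeta (2 * r - i + 2) : ℂ) * e3
      rw [sum_congr rfl hL, sum_congr rfl hR, hc, hpow1, hpow3]
      push_cast
      ring
    · intro i hi
      rw [show 2 * r - (2 * r - i) = i by omega, mul_comm]
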